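/- Let $N\ge 2$, $0<s<1$, and let $\mathbb R^N_+=\{x\in\mathbb R^N : x_N>0\}$. For a function $v$ put $$(-\Delta)^s v(x)=\lim_{\varepsilon\to 0^+}\int_{\mathbb R^N\setminus B_\varepsilon(x)}\frac{v(x)-v(y)}{|x-y|^{N+2s}}\,dy$$ (a positive normalization constant is omitted) whenever these integrals converge absolutely and the limit exists. For an open set $D\subset\mathbb R^N$ and a bounded function $u\in C(\mathbb R^N)$, the inequality $(-\Delta)^s u\ge 0$ in $D$ is said to hold in the viscosity sense if for every $x_0\in D$, every bounded open neighbourhood $U\subset D$ of $x_0$ and every $\varphi\in C^\infty(\mathbb R^N)$ with $\varphi(x_0)=u(x_0)$ and $\varphi<u$ in $U\setminus\{x_0\}$, the function $\psi$ given by $\psi=\varphi$ in $U$ and $\psi=u$ in $\mathbb R^N\setminus U$ satisfies $(-\Delta)^s\psi(x_0)\ge 0$. Let $D\subset\mathbb R^N_+$ be a domain (a nonempty, connected, open set, possibly unbounded), and let $u\in C(\mathbb R^N)$ be a bounded function such that $(-\Delta)^s u\ge 0$ in $D$ in the viscosity sense and $u\ge 0$ in $\mathbb R^N\setminus D$. Then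 $u\ge 0$ in $D$. -/

import Mathlib

open scoped ContDiff

/-- The open half-space `{x ∈ ℝ^N : x_N > 0}`: the last coordinate is positive. -/
def halfSpace (N : ℕ) : Set (EuclideanSpace ℝ (Fin N)) :=
  {x | ∀ i : Fin N, (i : ℕ) + 1 = N → 0 < x i}

/-- `(-Δ)^s v (x)` exists as a principal value and equals `L` (normalization constant omitted):
the integrals of `(v(x) - v(y)) / |x - y|^{N+2s}` over the complements of the balls `B_ε(x)`
converge absolutely, and they tend to `L` as `ε → 0⁺`. -/
def HasFracLaplacianAt {N : ℕ} (s : ℝ) (v : EuclideanSpace ℝ (Fin N) → ℝ)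
    (x : EuclideanSpace ℝ (Fin N)) (L : ℝ) : Prop :=
  (∀ ε : ℝ, 0 < ε → MeasureTheory.IntegrableOn
    (fun y => (v x - v y) / ‖x - y‖ ^ ((N : ℝ) + 2 * s)) (Metric.ball x ε)ᶜ) ∧
  Filter.Tendsto
    (fun ε : ℝ => ∫ y in (Metric.ball x ε)ᶜ, (v x - v y) / ‖x - y‖ ^ ((N : ℝ) + 2 * s))
    (nhdsWithin 0 (Set.Ioi 0)) (nhds L)

open Classical in
/-- `(-Δ)^s u ≥ 0` in `D` in the viscosity sense: whenever `x₀ ∈ D`, `U ⊆ D` is a bounded open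
neighbourhood of `x₀`, and `φ ∈ C^∞(ℝ^N)` touches `u` from below at `x₀`, strictly in
`U \ {x₀}`, the function `ψ` equal to `φ` in `U` and to `u` outside `U` satisfies
`(-Δ)^s ψ (x₀) ≥ 0`. -/
def IsViscositySupersolution {N : ℕ} (s : ℝ) (D : Set (EuclideanSpace ℝ (Fin N)))
    (u : EuclideanSpace ℝ (Fin N) → ℝ) : Prop :=
  ∀ x₀ ∈ D, ∀ U : Set (EuclideanSpace ℝ (Fin N)),
    IsOpen U → x₀ ∈ U → U ⊆ D → Bornology.IsBounded U →
    ∀ φ : EuclideanSpace ℝ (Fin N) → ℝ, ContDiff ℝ ∞ φ →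
      φ x₀ = u x₀ → (∀ y ∈ U, y ≠ x₀ → φ y < u y) →
      ∃ L : ℝ, HasFracLaplacianAt s (U.piecewise φ u) x₀ L ∧ 0 ≤ L

/-!
Suppose `inf u = -m < 0`, and let `x₀` be a point where `u` is within `η` of its infimum. A ball of
radius `2d` comparable to its distance from `x₀` lies outside `D`. Within distance `d` of `x₀` the
function `u` is touched from below, at some `x`, by a paraboloid of opening `η / d²`. Testing the
supersolution property there, the increments of the test function are at most
`2η min(1, |z|² / d²)` up to the linear term of the paraboloid, which is odd and drops out; they
contribute at most a multiple of `η d^{-2s}` to the fractional Laplacian, while the exterior ball,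
where `u ≥ 0`, contributes at most a negative multiple of `m d^{-2s}`. Since both
terms scale alike in `d`, taking `η` to be a small multiple of `m` gives a contradiction.
-/

open MeasureTheory Metric Set Filter Topology Module

section Paraboloid

variable {E : Type*} [NormedAddCommGroup E] [InnerProductSpace ℝ E]

theorem exists_touching_paraboloid [ProperSpace E] {u : E → ℝ}
    (hu : LowerSemicontinuous u) {a η d : ℝ} (hd : 0 < d) (ha : ∀ y, a ≤ u y) {x₀ : E}
    (hx₀ : u x₀ ≤ a + η) :
    ∃ x ∈ closedBall x₀ d, u x ≤ u x₀ ∧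
      ∃ p : E, ∀ z, u x - u (x + z) ≤ inner ℝ p z + η / d ^ 2 * ‖z‖ ^ 2 := by
  set b : ℝ := η / d ^ 2 with hb
  have hbd : b * d ^ 2 = η := by rw [hb]; field_simp
  have hb0 : 0 ≤ b := div_nonneg (by linarith [ha x₀]) (by positivity)
  have hcont : Continuous fun y => b * ‖y - x₀‖ ^ 2 := by fun_prop
  obtain ⟨x, hx, hmin⟩ := ((hu.add hcont.lowerSemicontinuous).lowerSemicontinuousOn
    (closedBall x₀ d)).exists_isMinOn ⟨x₀, mem_closedBall_self hd.le⟩ (isCompact_closedBall x₀ d)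
  have hx_le : u x + b * ‖x - x₀‖ ^ 2 ≤ u x₀ := by
    simpa using hmin (mem_closedBall_self hd.le)
  -- Outside the ball the quadratic term is at least `η`, so a minimum over the ball is global.
  have hmin_global (y : E) : u x + b * ‖x - x₀‖ ^ 2 ≤ u y + b * ‖y - x₀‖ ^ 2 := by
    by_cases hy : y ∈ closedBall x₀ d
    · exact hmin hy
    · have hy' : d < ‖y - x₀‖ := by simpa [dist_eq_norm] using hy
      have : b * d ^ 2 ≤ b * ‖y - x₀‖ ^ 2 := by gcongr
      linarith [ha y]
  refine ⟨x, hx, ?_, (2 * b) • (x - x₀), fun z => ?_⟩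
  · linarith [mul_nonneg hb0 (sq_nonneg ‖x - x₀‖)]
  · have hexp : ‖x + z - x₀‖ ^ 2 = ‖x - x₀‖ ^ 2 + 2 * inner ℝ (x - x₀) z + ‖z‖ ^ 2 := by
      rw [← norm_add_sq_real, sub_add_eq_add_sub]
    have := hmin_global (x + z)
    rw [hexp] at this
    rw [real_inner_smul_left]
    linarith

end Paraboloid

section Kernel

theorem integrable_min_one_norm_sq_mul_inv_norm_rpow {E : Type*} [NormedAddCommGroup E]
    [NormedSpace ℝ E] [FiniteDimensional ℝ E] [MeasurableSpace E] [BorelSpace E]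
    (μ : Measure E) [μ.IsAddHaarMeasure] {q : ℝ} (hq : finrank ℝ E < q)
    (hq' : q < finrank ℝ E + 2) :
    Integrable (fun z => min 1 (‖z‖ ^ 2) * (‖z‖ ^ q)⁻¹) μ := by
  cases subsingleton_or_nontrivial E
  · exact .of_subsingleton
  rw [integrable_fun_norm_addHaar μ (f := fun r : ℝ => min 1 (r ^ 2) * (r ^ q)⁻¹),
    ← Ioc_union_Ioi_eq_Ioi zero_le_one, integrableOn_union]
  have radial_pow {r : ℝ} (hr : 0 < r) :
      r ^ (finrank ℝ E - 1) * (r ^ q)⁻¹ = r ^ (finrank ℝ E - 1 - q) := by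
    rw [← Real.rpow_neg hr.le, ← Real.rpow_natCast, ← Real.rpow_add hr,
      Nat.cast_pred finrank_pos, ← sub_eq_add_neg]
  constructor
  · refine (intervalIntegral.intervalIntegrable_rpow' (a := 0) (b := 1)
      (show -1 < finrank ℝ E - 1 - q + 2 by linarith)).1.congr_fun (fun r hr => ?_)
      measurableSet_Ioc
    have hmin : min 1 (r ^ 2) = r ^ 2 := min_eq_right (pow_le_one₀ hr.1.le hr.2)
    simp only [smul_eq_mul, hmin, Real.rpow_add hr.1, Real.rpow_two, ← radial_pow hr.1]
    ring
  · refine (integrableOn_Ioi_rpow_of_lt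
      (show finrank ℝ E - 1 - q < -1 by linarith) zero_lt_one).congr_fun (fun r hr => ?_)
      measurableSet_Ioi
    have hmin : min 1 (r ^ 2) = 1 := min_eq_left (one_le_pow₀ (le_of_lt hr))
    simp only [smul_eq_mul, hmin, one_mul, ← radial_pow (zero_lt_one.trans hr)]

variable {N : ℕ} {s : ℝ}

/-- The kernel `|z|^{-N-2s}` of the fractional Laplacian; it takes the junk value `0` at the
origin when `0 < s`. -/
noncomputable def fracKernel (s : ℝ) (z : EuclideanSpace ℝ (Fin N)) : ℝ :=
  (‖z‖ ^ ((N : ℝ) + 2 * s))⁻¹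

/-- The truncated second moment `∫ min(1, |z|²) |z|^{-N-2s} dz` of the kernel. -/
noncomputable def fracKernelMoment (N : ℕ) (s : ℝ) : ℝ :=
  ∫ z : EuclideanSpace ℝ (Fin N), min 1 (‖z‖ ^ 2) * fracKernel s z

theorem fracKernel_nonneg (z : EuclideanSpace ℝ (Fin N)) : 0 ≤ fracKernel s z := by
  unfold fracKernel
  positivity

theorem fracKernel_zero (hs : 0 < s) : fracKernel s (0 : EuclideanSpace ℝ (Fin N)) = 0 := by
  rw [fracKernel, norm_zero, Real.zero_rpow (by positivity), inv_zero]

theorem fracKernel_neg (z : EuclideanSpace ℝ (Fin N)) : fracKernel s (-z) = fracKernel s z := by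
  rw [fracKernel, fracKernel, norm_neg]

theorem fracKernel_smul {d : ℝ} (hd : 0 ≤ d) (z : EuclideanSpace ℝ (Fin N)) :
    fracKernel s (d • z) = (d ^ ((N : ℝ) + 2 * s))⁻¹ * fracKernel s z := by
  rw [fracKernel, fracKernel, norm_smul, Real.norm_of_nonneg hd,
    Real.mul_rpow hd (norm_nonneg z), mul_inv]

theorem continuousOn_fracKernel :
    ContinuousOn (fracKernel s) ({0}ᶜ : Set (EuclideanSpace ℝ (Fin N))) := by
  refine ContinuousOn.inv₀ (continuous_norm.continuousOn.rpow_const fun z hz => ?_) fun z hz => ?_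
  · exact Or.inl (norm_ne_zero_iff.2 hz)
  · exact (Real.rpow_pos_of_pos (norm_pos_iff.2 hz) _).ne'

theorem fracKernelMoment_nonneg : 0 ≤ fracKernelMoment N s :=
  integral_nonneg fun z => mul_nonneg (by positivity) (fracKernel_nonneg z)

theorem integrable_min_one_norm_sq_mul_fracKernel (hs0 : 0 < s) (hs1 : s < 1) :
    Integrable fun z : EuclideanSpace ℝ (Fin N) => min 1 (‖z‖ ^ 2) * fracKernel s z :=
  integrable_min_one_norm_sq_mul_inv_norm_rpow volume
    (by rw [finrank_euclideanSpace_fin]; linarith) (by rw [finrank_euclideanSpace_fin]; linarith)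

theorem mul_fracKernel_eq_comp_inv_smul {d : ℝ} (hd : 0 < d) (f : EuclideanSpace ℝ (Fin N) → ℝ) :
    (fun z => f (d⁻¹ • z) * fracKernel s z) = fun z => (d ^ ((N : ℝ) + 2 * s))⁻¹ *
      (f (d⁻¹ • z) * fracKernel s (d⁻¹ • z)) := by
  funext z
  rw [mul_left_comm, ← fracKernel_smul hd.le, smul_inv_smul₀ hd.ne']

theorem integrable_comp_inv_smul_mul_fracKernel {d : ℝ} (hd : 0 < d)
    {f : EuclideanSpace ℝ (Fin N) → ℝ} (hf : Integrable fun z => f z * fracKernel s z) :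
    Integrable fun z => f (d⁻¹ • z) * fracKernel s z := by
  rw [mul_fracKernel_eq_comp_inv_smul hd]
  exact (hf.comp_smul (inv_ne_zero hd.ne')).const_mul _

theorem integral_comp_inv_smul_mul_fracKernel {d : ℝ} (hd : 0 < d)
    (f : EuclideanSpace ℝ (Fin N) → ℝ) :
    ∫ z, f (d⁻¹ • z) * fracKernel s z = (d ^ (2 * s))⁻¹ * ∫ z, f z * fracKernel s z := by
  rw [mul_fracKernel_eq_comp_inv_smul hd, integral_const_mul,
    Measure.integral_comp_inv_smul_of_nonneg volume (fun z => f z * fracKernel s z) hd.le,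
    finrank_euclideanSpace_fin, smul_eq_mul, Real.rpow_add hd, Real.rpow_natCast]
  field_simp

theorem integrableOn_fracKernel_compl_ball (hs0 : 0 < s) (hs1 : s < 1) {d : ℝ} (hd : 0 < d) :
    IntegrableOn (fracKernel s) (ball (0 : EuclideanSpace ℝ (Fin N)) d)ᶜ := by
  refine (integrable_comp_inv_smul_mul_fracKernel hd
    (integrable_min_one_norm_sq_mul_fracKernel hs0 hs1)).integrableOn.congr_fun
    (fun z hz => ?_) measurableSet_ball.compl
  have hz : d ≤ ‖z‖ := by simpa using hz
  have hdz : 1 ≤ ‖d⁻¹ • z‖ := by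
    rwa [norm_smul, norm_inv, Real.norm_of_nonneg hd.le, ← div_eq_inv_mul, one_le_div hd]
  simp only [min_eq_left (one_le_pow₀ hdz), one_mul]

theorem le_setIntegral_fracKernel_ball (hs0 : 0 < s) (hs1 : s < 1) {d R : ℝ} (hd : 0 < d)
    (hR : 0 ≤ R) {a : EuclideanSpace ℝ (Fin N)} (had : ball a d ⊆ (ball 0 d)ᶜ)
    (haR : ball a d ⊆ ball 0 (R * d)) :
    (d ^ (2 * s))⁻¹ * ((R ^ ((N : ℝ) + 2 * s))⁻¹ *
      volume.real (ball (0 : EuclideanSpace ℝ (Fin N)) 1)) ≤ ∫ z in ball a d, fracKernel s z := by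
  have hvol : volume.real (ball a d)
      = d ^ N * volume.real (ball (0 : EuclideanSpace ℝ (Fin N)) 1) := by
    rw [measureReal_def, Measure.addHaar_ball_of_pos volume a hd, finrank_euclideanSpace_fin,
      ENNReal.toReal_mul, ENNReal.toReal_ofReal (by positivity), measureReal_def]
  have hkernel : ∀ z ∈ ball a d, ((R * d) ^ ((N : ℝ) + 2 * s))⁻¹ ≤ fracKernel s z := by
    intro z hz
    have hdz : d ≤ ‖z‖ := by simpa using had hz
    have hzR : ‖z‖ ≤ R * d := by simpa using (mem_ball_zero_iff.1 (haR hz)).le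
    have : 0 < ‖z‖ := hd.trans_le hdz
    unfold fracKernel
    gcongr
  calc _ = ((R * d) ^ ((N : ℝ) + 2 * s))⁻¹ * volume.real (ball a d) := by
        rw [hvol, Real.mul_rpow hR hd.le, Real.rpow_add hd, Real.rpow_natCast]
        field_simp
    _ ≤ _ := setIntegral_ge_of_const_le_real measurableSet_ball measure_ball_lt_top.ne hkernel
        ((integrableOn_fracKernel_compl_ball hs0 hs1 hd).mono_set had)

theorem integrable_and_integral_min_sub_indicator_mul_fracKernel (hs0 : 0 < s) (hs1 : s < 1)
    {d : ℝ} (hd : 0 < d) {B : Set (EuclideanSpace ℝ (Fin N))} (hB : MeasurableSet B)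
    (hBd : B ⊆ (ball 0 d)ᶜ) (a m : ℝ) :
    Integrable (fun z => (a * min 1 (‖d⁻¹ • z‖ ^ 2) - m * B.indicator 1 z) * fracKernel s z) ∧
    ∫ z, (a * min 1 (‖d⁻¹ • z‖ ^ 2) - m * B.indicator 1 z) * fracKernel s z =
      (d ^ (2 * s))⁻¹ * (a * fracKernelMoment N s) - m * ∫ z in B, fracKernel s z := by
  have hsplit (z : EuclideanSpace ℝ (Fin N)) :
      (a * min 1 (‖d⁻¹ • z‖ ^ 2) - m * B.indicator 1 z) * fracKernel s z =
        a * (min 1 (‖d⁻¹ • z‖ ^ 2) * fracKernel s z) - m * B.indicator (fracKernel s) z := by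
    by_cases hzB : z ∈ B
    · simp only [indicator_of_mem hzB, Pi.one_apply]
      ring
    · simp only [indicator_of_notMem hzB]
      ring
  have hmin_int := (integrable_comp_inv_smul_mul_fracKernel hd
    (integrable_min_one_norm_sq_mul_fracKernel (N := N) hs0 hs1)).const_mul a
  have hB_int := ((integrable_indicator_iff hB).2
    ((integrableOn_fracKernel_compl_ball hs0 hs1 hd).mono_set hBd)).const_mul m
  simp only [hsplit]
  refine ⟨hmin_int.sub hB_int, ?_⟩
  rw [integral_sub hmin_int hB_int, integral_const_mul, integral_const_mul,
    integral_indicator hB, integral_comp_inv_smul_mul_fracKernel hd fun z => min 1 (‖z‖ ^ 2),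
    ← fracKernelMoment, mul_left_comm]

end Kernel

section PrincipalValue

theorem setIntegral_eq_zero_of_odd {G F : Type*} [MeasurableSpace G] [AddGroup G]
    [MeasurableNeg G] {μ : Measure G} [μ.IsNegInvariant] [NormedAddCommGroup F] [NormedSpace ℝ F]
    {f : G → F} (hf : f.Odd) {S : Set G} (hS : -S = S) : ∫ z in S, f z ∂μ = 0 := by
  have h := (Measure.measurePreserving_neg μ).setIntegral_preimage_emb
    (MeasurableEquiv.neg G).measurableEmbedding f S
  have : IsAddTorsionFree F := .of_isTorsionFree ℝ F
  rwa [show Neg.neg ⁻¹' S = S from hS, funext hf, integral_neg, neg_eq_self] at h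

theorem tendsto_setIntegral_compl_ball {X F : Type*} [MetricSpace X] [MeasurableSpace X]
    [OpensMeasurableSpace X] {μ : Measure X} [NormedAddCommGroup F] [NormedSpace ℝ F] {f : X → F}
    (hf : Integrable f μ) {x : X} (hx : f x = 0) :
    Tendsto (fun ε => ∫ y in (ball x ε)ᶜ, f y ∂μ) (𝓝[>] 0) (𝓝 (∫ y, f y ∂μ)) := by
  simp only [← integral_indicator measurableSet_ball.compl]
  refine tendsto_integral_filter_of_dominated_convergence (fun y => ‖f y‖)
    (.of_forall fun ε => hf.aestronglyMeasurable.indicator measurableSet_ball.compl)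
    (.of_forall fun ε => .of_forall fun y => norm_indicator_le_norm_self f y) hf.norm
    (.of_forall fun y => tendsto_const_nhds.congr' ?_)
  rcases eq_or_ne y x with rfl | hyx
  · exact .of_forall fun ε => (indicator_apply_eq_self.2 fun _ => hx).symm
  · filter_upwards [Ioo_mem_nhdsGT (dist_pos.2 hyx)] with ε hε
    rw [indicator_of_mem]
    simpa using hε.2.le

variable {N : ℕ} {s : ℝ}

theorem hasFracLaplacianAt_iff_centered {v : EuclideanSpace ℝ (Fin N) → ℝ}
    {x : EuclideanSpace ℝ (Fin N)} {L : ℝ} :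
    HasFracLaplacianAt s v x L ↔
      (∀ ε : ℝ, 0 < ε →
        IntegrableOn (fun z => (v x - v (x + z)) * fracKernel s z) (ball 0 ε)ᶜ) ∧
      Tendsto (fun ε : ℝ => ∫ z in (ball 0 ε)ᶜ, (v x - v (x + z)) * fracKernel s z)
        (𝓝[>] 0) (𝓝 L) := by
  have hshift := measurePreserving_add_left (volume : Measure (EuclideanSpace ℝ (Fin N))) x
  have hemb := (Homeomorph.addLeft x).measurableEmbedding
  have hball (ε : ℝ) : (x + ·) ⁻¹' (ball x ε)ᶜ = (ball 0 ε)ᶜ := by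
    rw [preimage_compl, preimage_add_ball, sub_self]
  let F : EuclideanSpace ℝ (Fin N) → ℝ := fun y => (v x - v y) / ‖x - y‖ ^ ((N : ℝ) + 2 * s)
  have hF (z : EuclideanSpace ℝ (Fin N)) : (v x - v (x + z)) * fracKernel s z = F (x + z) := by
    simp only [F, sub_add_cancel_left, norm_neg, fracKernel, div_eq_mul_inv]
  simp only [hF, ← hball, hshift.setIntegral_preimage_emb hemb F]
  exact and_congr_left' (forall₂_congr fun ε _ => (hshift.integrableOn_comp_preimage hemb).symm)

theorem HasFracLaplacianAt.le_integral_of_increment_le (hs : 0 < s)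
    {v : EuclideanSpace ℝ (Fin N) → ℝ} {x : EuclideanSpace ℝ (Fin N)} {L : ℝ}
    (hL : HasFracLaplacianAt s v x L) {g o : EuclideanSpace ℝ (Fin N) → ℝ}
    (hg : Integrable fun z => g z * fracKernel s z) (ho : o.Odd)
    (ho_int : ∀ ε : ℝ, 0 < ε → IntegrableOn (fun z => o z * fracKernel s z) (ball 0 ε)ᶜ)
    (hle : ∀ z, v x - v (x + z) ≤ g z + o z) :
    L ≤ ∫ z, g z * fracKernel s z := by
  obtain ⟨hv_int, hv_lim⟩ := hasFracLaplacianAt_iff_centered.1 hL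
  have ho_zero (ε : ℝ) : ∫ z in (ball 0 ε)ᶜ, o z * fracKernel s z = 0 :=
    setIntegral_eq_zero_of_odd (ho.mul_even fracKernel_neg) (by simp)
  refine le_of_tendsto_of_tendsto hv_lim
    (tendsto_setIntegral_compl_ball hg (by rw [fracKernel_zero hs, mul_zero])) ?_
  filter_upwards [self_mem_nhdsWithin] with ε hε
  calc ∫ z in (ball 0 ε)ᶜ, (v x - v (x + z)) * fracKernel s z
      ≤ ∫ z in (ball 0 ε)ᶜ, (g z * fracKernel s z + o z * fracKernel s z) :=
        integral_mono (hv_int ε hε) (hg.integrableOn.add (ho_int ε hε)) fun z => by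
          rw [← add_mul]
          exact mul_le_mul_of_nonneg_right (hle z) (fracKernel_nonneg z)
    _ = ∫ z in (ball 0 ε)ᶜ, g z * fracKernel s z := by
        rw [integral_add hg.integrableOn (ho_int ε hε), ho_zero, add_zero]

theorem integrableOn_indicator_inner_mul_fracKernel (p : EuclideanSpace ℝ (Fin N)) (d : ℝ)
    {ε : ℝ} (hε : 0 < ε) :
    IntegrableOn (fun z => (ball 0 d).indicator (fun z => inner ℝ p z) z * fracKernel s z)
      (ball 0 ε)ᶜ := by
  have hcont : ContinuousOn (fun z => inner ℝ p z * fracKernel s z)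
      (closedBall 0 d ∩ (ball 0 ε)ᶜ) :=
    ContinuousOn.mul (by fun_prop) (continuousOn_fracKernel.mono fun z hz hz0 =>
      hz.2 (by rw [hz0]; exact mem_ball_self hε))
  have hcompact := (isCompact_closedBall (0 : EuclideanSpace ℝ (Fin N)) d).inter_right
    isOpen_ball.isClosed_compl (t := (ball 0 ε)ᶜ)
  simp only [← indicator_mul_left]
  rw [integrableOn_indicator_iff measurableSet_ball]
  exact (hcont.integrableOn_compact hcompact).mono_set
    (inter_subset_inter_left _ ball_subset_closedBall)

variable {D : Set (EuclideanSpace ℝ (Fin N))} {u : EuclideanSpace ℝ (Fin N) → ℝ}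

theorem IsViscositySupersolution.exists_test_of_touching (hu : IsViscositySupersolution s D u)
    (hD : IsOpen D) {x p : EuclideanSpace ℝ (Fin N)} (hx : x ∈ D) {b c d : ℝ} (hbc : b < c)
    (hd : 0 < d) (htouch : ∀ z ∈ ball 0 d, u x - u (x + z) ≤ inner ℝ p z + b * ‖z‖ ^ 2) :
    ∃ ψ L, HasFracLaplacianAt s ψ x L ∧ 0 ≤ L ∧
      (∀ z ∈ ball 0 d, ψ x - ψ (x + z) ≤ inner ℝ p z + c * ‖z‖ ^ 2) ∧
      ∀ z ∉ ball 0 d, ψ x - ψ (x + z) = u x - u (x + z) := by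
  let φ : EuclideanSpace ℝ (Fin N) → ℝ :=
    fun y => u x - (inner ℝ p (y - x) + c * ‖y - x‖ ^ 2)
  let U := ball x d ∩ D
  have hφ_smooth : ContDiff ℝ ∞ φ := by
    have hsub : ContDiff ℝ ∞ fun y : EuclideanSpace ℝ (Fin N) => y - x :=
      contDiff_id.sub contDiff_const
    exact contDiff_const.sub ((contDiff_const.inner ℝ hsub).add
      (contDiff_const.mul (hsub.norm_sq ℝ)))
  have hφx : φ x = u x := by simp [φ]
  have hφ_lt : ∀ y ∈ U, y ≠ x → φ y < u y := fun y hy hyx => by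
    have hy_touch := htouch (y - x) (by simpa [dist_eq_norm] using hy.1)
    have : b * ‖y - x‖ ^ 2 < c * ‖y - x‖ ^ 2 :=
      mul_lt_mul_of_pos_right hbc (pow_pos (norm_pos_iff.2 (sub_ne_zero.2 hyx)) 2)
    rw [add_sub_cancel] at hy_touch
    linarith
  have hxU : x ∈ U := ⟨mem_ball_self hd, hx⟩
  obtain ⟨L, hL, hL0⟩ := hu x hx U (isOpen_ball.inter hD) hxU inter_subset_right
    (isBounded_ball.subset inter_subset_left) φ hφ_smooth hφx hφ_lt
  refine ⟨_, L, hL, hL0, fun z hz => ?_, fun z hz => ?_⟩ <;>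
    simp only [piecewise, if_pos hxU, hφx]
  · by_cases hzU : x + z ∈ U
    · simp only [if_pos hzU, φ, add_sub_cancel_left, sub_sub_cancel, le_refl]
    · rw [if_neg hzU]
      exact (htouch z hz).trans (by gcongr)
  · have hzU : x + z ∉ U := fun h => hz (by simpa using h.1)
    rw [if_neg hzU]

theorem IsViscositySupersolution.integral_nonneg_of_touching (hu : IsViscositySupersolution s D u)
    (hs : 0 < s) (hD : IsOpen D) {x p : EuclideanSpace ℝ (Fin N)} (hx : x ∈ D) {b c d : ℝ}
    (hbc : b < c) (hd : 0 < d)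
    (htouch : ∀ z ∈ ball 0 d, u x - u (x + z) ≤ inner ℝ p z + b * ‖z‖ ^ 2)
    {g : EuclideanSpace ℝ (Fin N) → ℝ} (hg : Integrable fun z => g z * fracKernel s z)
    (hg_near : ∀ z ∈ ball 0 d, c * ‖z‖ ^ 2 ≤ g z)
    (hg_far : ∀ z ∉ ball 0 d, u x - u (x + z) ≤ g z) :
    0 ≤ ∫ z, g z * fracKernel s z := by
  obtain ⟨ψ, L, hL, hL0, hψ_near, hψ_far⟩ := hu.exists_test_of_touching hD hx hbc hd htouch
  have hodd : ((ball 0 d).indicator fun z => inner ℝ p z).Odd := fun z => by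
    simp only [indicator, mem_ball_zero_iff, norm_neg, inner_neg_right]
    split_ifs <;> simp only [neg_zero]
  refine hL0.trans (hL.le_integral_of_increment_le hs hg hodd
    (fun ε => integrableOn_indicator_inner_mul_fracKernel p d) fun z => ?_)
  by_cases hz : z ∈ ball 0 d
  · rw [indicator_of_mem hz]
    linarith [hψ_near z hz, hg_near z hz]
  · rw [indicator_of_notMem hz, add_zero, hψ_far z hz]
    exact hg_far z hz

theorem IsViscositySupersolution.mul_setIntegral_fracKernel_le_of_touching
    (hu : IsViscositySupersolution s D u) (hs0 : 0 < s) (hs1 : s < 1) (hD : IsOpen D)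
    {x p : EuclideanSpace ℝ (Fin N)} (hx : x ∈ D) {m η d : ℝ} (hη : 0 < η) (hd : 0 < d)
    (htouch : ∀ z, u x - u (x + z) ≤ inner ℝ p z + η / d ^ 2 * ‖z‖ ^ 2) (hm : ∀ y, -m ≤ u y)
    (hux : u x ≤ -m + η) {B : Set (EuclideanSpace ℝ (Fin N))} (hB : MeasurableSet B)
    (hBd : B ⊆ (ball 0 d)ᶜ) (huB : ∀ z ∈ B, 0 ≤ u (x + z)) :
    m * ∫ z in B, fracKernel s z ≤ (d ^ (2 * s))⁻¹ * (2 * η * fracKernelMoment N s) := by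
  let g : EuclideanSpace ℝ (Fin N) → ℝ :=
    fun z => 2 * η * min 1 (‖d⁻¹ • z‖ ^ 2) - m * B.indicator 1 z
  have hnorm (z : EuclideanSpace ℝ (Fin N)) : ‖d⁻¹ • z‖ = ‖z‖ / d := by
    rw [norm_smul, norm_inv, Real.norm_of_nonneg hd.le, inv_mul_eq_div]
  have hg_near : ∀ z ∈ ball 0 d, 2 * η / d ^ 2 * ‖z‖ ^ 2 ≤ g z := fun z hz => by
    have hz1 : ‖z‖ / d ≤ 1 := (div_le_one hd).2 (mem_ball_zero_iff.1 hz).le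
    simp only [g, hnorm, min_eq_right (pow_le_one₀ (by positivity) hz1),
      indicator_of_notMem fun hzB => hBd hzB hz]
    apply le_of_eq
    ring
  have hg_far : ∀ z ∉ ball 0 d, u x - u (x + z) ≤ g z := fun z hz => by
    have hz1 : 1 ≤ ‖z‖ / d := (one_le_div hd).2 (by simpa using hz)
    simp only [g, hnorm, min_eq_left (one_le_pow₀ hz1)]
    by_cases hzB : z ∈ B
    · rw [indicator_of_mem hzB, Pi.one_apply]
      linarith [huB z hzB]
    · rw [indicator_of_notMem hzB]
      linarith [hm (x + z)]
  obtain ⟨hg_int, hg_integral⟩ :=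
    integrable_and_integral_min_sub_indicator_mul_fracKernel hs0 hs1 hd hB hBd (2 * η) m
  have hnonneg := hu.integral_nonneg_of_touching hs0 hD hx
    (div_lt_div_of_pos_right (by linarith : η < 2 * η) (by positivity)) hd (fun z _ => htouch z)
    hg_int hg_near hg_far
  exact sub_nonneg.1 (hg_integral ▸ hnonneg)

end PrincipalValue

section ExteriorBalls

/-- The uniform exterior ball condition, invariant under dilations: each `x ∈ D` admits a ball
`B_r(y)` outside `D` with `|x - y| ≤ κ r`. The radius `r` may depend on `x`. -/
def HasExteriorBalls {X : Type*} [PseudoMetricSpace X] (κ : ℝ) (D : Set X) : Prop :=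
  ∀ x ∈ D, ∃ y r, 0 < r ∧ dist x y ≤ κ * r ∧ Disjoint (ball y r) D

theorem HasExteriorBalls.mono {X : Type*} [PseudoMetricSpace X] {κ : ℝ} {D D' : Set X}
    (hD : HasExteriorBalls κ D) (h : D' ⊆ D) : HasExteriorBalls κ D' := fun x hx =>
  let ⟨y, r, hr, hxy, hdisj⟩ := hD x (h hx)
  ⟨y, r, hr, hxy, hdisj.mono_right h⟩

theorem HasExteriorBalls.nonneg {X : Type*} [PseudoMetricSpace X] {κ : ℝ} {D : Set X}
    (hD : HasExteriorBalls κ D) (hne : D.Nonempty) : 0 ≤ κ :=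
  let ⟨x, hx⟩ := hne
  let ⟨_, _, hr, hxy, _⟩ := hD x hx
  nonneg_of_mul_nonneg_left (dist_nonneg.trans hxy) hr

theorem hasExteriorBalls_halfSpace {N : ℕ} (hN : 0 < N) : HasExteriorBalls 2 (halfSpace N) := by
  intro x hx
  let i : Fin N := ⟨N - 1, Nat.sub_lt hN one_pos⟩
  have hi : (i : ℕ) + 1 = N := Nat.sub_add_cancel hN
  have hxi : 0 < x i := hx i hi
  refine ⟨x - EuclideanSpace.single i (2 * x i), x i, hxi, ?_, ?_⟩
  · simp [abs_of_pos hxi]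
  · refine Set.disjoint_left.2 fun w hw hwD => ?_
    have hcoord : w i - (x i - 2 * x i) < x i := by
      simpa using (le_abs_self _).trans_lt ((PiLp.norm_apply_le _ i).trans_lt
        (mem_ball_iff_norm.1 hw))
    linarith [hwD i hi]

variable {N : ℕ} {s κ : ℝ} {D : Set (EuclideanSpace ℝ (Fin N))}
  {u : EuclideanSpace ℝ (Fin N) → ℝ}

theorem IsViscositySupersolution.mul_le_of_near_min (hu : IsViscositySupersolution s D u)
    (hs0 : 0 < s) (hs1 : s < 1) (hDopen : IsOpen D) (hD : HasExteriorBalls κ D)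
    (hu_lsc : LowerSemicontinuous u) (hout : ∀ x ∉ D, 0 ≤ u x) {m η : ℝ} (hη : 0 < η)
    (hηm : η < m) (hm : ∀ y, -m ≤ u y) {x₀ : EuclideanSpace ℝ (Fin N)} (hx₀ : u x₀ ≤ -m + η) :
    m * (((2 * κ + 2) ^ ((N : ℝ) + 2 * s))⁻¹ *
      volume.real (ball (0 : EuclideanSpace ℝ (Fin N)) 1)) ≤ 2 * η * fracKernelMoment N s := by
  have mem_D {x} (hx : u x ≤ -m + η) : x ∈ D := by
    by_contra hxD
    linarith [hout x hxD]
  obtain ⟨y, r, hr, hxy, hdisj⟩ := hD x₀ (mem_D hx₀)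
  obtain ⟨d, rfl⟩ : ∃ d, r = 2 * d := ⟨r / 2, by ring⟩
  have hd : 0 < d := by linarith
  obtain ⟨x, hx, hux, p, htouch⟩ := exists_touching_paraboloid hu_lsc hd hm hx₀
  have hxD : x ∈ D := mem_D (hux.trans hx₀)
  have hfar : 2 * d ≤ dist x y := by simpa using disjoint_right.1 hdisj hxD
  have hnear : dist x y ≤ (2 * κ + 1) * d := by
    linarith [dist_triangle x x₀ y, mem_closedBall.1 hx]
  have hxy_norm : dist (y - x) 0 = dist x y := by
    rw [dist_zero_right, dist_comm, dist_eq_norm]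
  have hB : ball (y - x) d ⊆ (ball 0 d)ᶜ :=
    subset_compl_iff_disjoint_right.2 (ball_disjoint_ball (by linarith))
  have hBR : ball (y - x) d ⊆ ball 0 ((2 * κ + 2) * d) := ball_subset_ball' (by linarith)
  have huB : ∀ z ∈ ball (y - x) d, 0 ≤ u (x + z) := fun z hz => by
    refine hout _ (disjoint_left.1 hdisj (ball_subset_ball (by linarith : d ≤ 2 * d) ?_))
    rwa [mem_ball_iff_norm, sub_sub_eq_add_sub, add_comm, ← mem_ball_iff_norm] at hz
  have hκ : 0 ≤ κ := hD.nonneg ⟨x, hxD⟩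
  have hupper := hu.mul_setIntegral_fracKernel_le_of_touching hs0 hs1 hDopen hxD hη hd htouch hm
    (hux.trans hx₀) measurableSet_ball hB huB
  have hlower := mul_le_mul_of_nonneg_left
    (le_setIntegral_fracKernel_ball hs0 hs1 hd (by positivity) hB hBR) (hη.trans hηm).le
  rw [mul_left_comm] at hlower
  exact le_of_mul_le_mul_left (hlower.trans hupper) (by positivity)

end ExteriorBalls

theorem lemma2p1_general {N : ℕ} {s κ : ℝ} (hs0 : 0 < s) (hs1 : s < 1)
    {D : Set (EuclideanSpace ℝ (Fin N))} (hDopen : IsOpen D) (hD : HasExteriorBalls κ D)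
    {u : EuclideanSpace ℝ (Fin N) → ℝ} (hu : LowerSemicontinuous u) (hbdd : BddBelow (range u))
    (hsuper : IsViscositySupersolution s D u) (hout : ∀ x, x ∉ D → 0 ≤ u x) (x) : 0 ≤ u x := by
  by_contra! hux
  obtain ⟨m, hm⟩ : ∃ m, -m = ⨅ y, u y := ⟨_, neg_neg _⟩
  have hlow (y) : -m ≤ u y := hm ▸ ciInf_le hbdd y
  have hm0 : 0 < m := by linarith [hlow x]
  set M := fracKernelMoment N s
  have hM : 0 ≤ M := fracKernelMoment_nonneg
  set c := ((2 * κ + 2) ^ ((N : ℝ) + 2 * s))⁻¹ *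
    volume.real (ball (0 : EuclideanSpace ℝ (Fin N)) 1)
  have hc : 0 < c := by
    have hκ : 0 ≤ κ := hD.nonneg ⟨x, by_contra fun hx => hux.not_ge (hout x hx)⟩
    have hball : 0 < volume.real (ball (0 : EuclideanSpace ℝ (Fin N)) 1) :=
      ENNReal.toReal_pos (measure_ball_pos volume 0 one_pos).ne' measure_ball_lt_top.ne
    positivity
  obtain ⟨δ, hδ0, hδ1, hδ⟩ : ∃ δ > 0, δ < 1 ∧ 2 * δ * M < c := by
    have hden : 0 < 2 * M + c + 1 := by positivity
    refine ⟨c / (2 * M + c + 1), by positivity, (div_lt_one hden).2 (by linarith), ?_⟩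
    rw [mul_assoc, div_mul_eq_mul_div, ← mul_div_assoc, div_lt_iff₀ hden]
    nlinarith
  obtain ⟨x₀, hx₀⟩ := exists_lt_of_ciInf_lt
    (hm.symm.trans_lt (lt_add_of_pos_right (-m) (mul_pos hδ0 hm0)))
  have hbalance := hsuper.mul_le_of_near_min hs0 hs1 hDopen hD hu hout (mul_pos hδ0 hm0)
    (mul_lt_of_lt_one_left hm0 hδ1) hlow hx₀.le
  refine hbalance.not_gt ?_
  calc 2 * (δ * m) * M = m * (2 * δ * M) := by ring
    _ < m * c := by gcongr

theorem lemma2p1 (N : ℕ) (hN : 2 ≤ N) (s : ℝ) (hs0 : 0 < s) (hs1 : s < 1)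
    (D : Set (EuclideanSpace ℝ (Fin N))) (hDopen : IsOpen D) (hDconn : IsConnected D)
    (hD : D ⊆ halfSpace N)
    (u : EuclideanSpace ℝ (Fin N) → ℝ) (hu : Continuous u) (hbdd : ∃ C : ℝ, ∀ x, |u x| ≤ C)
    (hsuper : IsViscositySupersolution s D u) (hout : ∀ x, x ∉ D → 0 ≤ u x) :
    ∀ x ∈ D, 0 ≤ u x := by
  obtain ⟨C, hC⟩ := hbdd
  exact fun x _ => lemma2p1_general hs0 hs1 hDopen
    ((hasExteriorBalls_halfSpace (by omega)).mono hD) hu.lowerSemicontinuous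
    ⟨-C, forall_mem_range.2 fun y => (abs_le.1 (hC y)).1⟩ hsuper hout x
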